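/- A graph consists of a set $V$ of vertices, a set $A$ of oriented edges, maps $\alpha,\omega:A\to V$ (source and destination) and an involution $e\mapsto\bar e$ of $A$, possibly with fixed points, such that $\alpha(\bar e)=\omega(e)$ for all $e\in A$; loops and multiple edges are allowed. A graph is locally finite if every vertex is the source of finitely many edges. The circuit series of a locally finite graph with base point $*$ is $G(t)=\sum_{\pi}t^{|\pi|}$, the sum being over all paths $\pi$ (sequences of consecutive edges, including the empty path) from $*$ to $*$, where $|\pi|$ is the number of edges of $\pi$. Let $(\mathcal E,*)$ and $(\mathcal F,*)$ be connected, locally finite pointed graphs. Their free product $\Gamma=\mathcal E*\mathcal F$ is the pointed graph obtained as follows: start with a copy of $\mathcal E$ and a copy of $\mathcal F$ identified at $*$; at each vertex $v\ne *$ of the copy of $\mathcal E$ (respectively $\mathcal F$) glue a new copy of $\mathcal F$ (respectively $\mathcal E$) by identifying its base point with $v$; repeat this process indefinitely at the new vertices. The base point of $\Gamma$ is the initial vertex $*$. Then $\Gamma$ is locally finite, and the circuit series $G_{\mathcal E}$, $G_{\mathcal F}$, $G_\Gamma$ of the three graphs at their base points satisfy $$\frac1{(tG_\Gamma)^{-1}}=\frac1{(tG_{\mathcal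 E})^{-1}}+\frac1{(tG_{\mathcal F})^{-1}}-\frac1t$$ in the field $\mathbb Q((t))$ of formal Laurent series. Here, for a power series $f$ with $f(0)=0$ and $f'(0)\neq0$, $f^{-1}$ denotes its compositional inverse, i.e. the power series $g$ with $f(g(t))=g(f(t))=t$. -/

import Mathlib

open PowerSeries

/-- A graph, possibly with loops and multiple edges, with vertex set `V` and set of oriented
edges `A`; the reversal of edges is an involution which may have fixed points. -/
structure InvGraph (V : Type*) (A : Type*) where
  /-- source of an edge -/
  src : A → V
  /-- destination of an edge -/
  tgt : A → V
  /-- reversal of edges -/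
  inv : A → A
  inv_inv : ∀ e, inv (inv e) = e
  src_inv : ∀ e, src (inv e) = tgt e

namespace InvGraph

variable {V A W B : Type*}

/-- `Γ.IsPath x p y`: the list of edges `p` is a path in `Γ` from `x` to `y`. A path is determined
by its starting vertex and its edges. -/
def IsPath (Γ : InvGraph V A) : V → List A → V → Prop
  | x, [], y => x = y
  | x, e :: p, y => Γ.src e = x ∧ Γ.IsPath (Γ.tgt e) p y

/-- Any two vertices are joined by a path. -/
def Connected (Γ : InvGraph V A) : Prop :=
  ∀ x y : V, ∃ p : List A, Γ.IsPath x p y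

/-- Every vertex has finite degree. -/
def LocallyFinite (Γ : InvGraph V A) : Prop :=
  ∀ x : V, {e : A | Γ.src e = x}.Finite

/-- The circuits of length `n` at the vertex `x`. -/
def circuits (Γ : InvGraph V A) (x : V) (n : ℕ) : Set (List A) :=
  {p | Γ.IsPath x p x ∧ p.length = n}

/-- The circuit series `G(t) = ∑ t ^ |π|`, the sum being over all circuits `π` at `x`. -/
noncomputable def circuitSeries (Γ : InvGraph V A) (x : V) : ℚ⟦X⟧ :=
  PowerSeries.mk fun n => ((Γ.circuits x n).ncard : ℚ)

theorem circuits_zero (Γ : InvGraph V A) (x : V) : Γ.circuits x 0 = {[]} := by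
  ext p
  cases p <;> simp [circuits, IsPath]

theorem constantCoeff_X_mul_circuitSeries (Γ : InvGraph V A) (x : V) :
    (X * Γ.circuitSeries x).constantCoeff = 0 := by
  simp

theorem isUnit_coeff_one_X_mul_circuitSeries (Γ : InvGraph V A) (x : V) :
    IsUnit ((X * Γ.circuitSeries x).coeff 1) := by
  have h : (X * Γ.circuitSeries x).coeff (0 + 1) = 1 := by
    rw [PowerSeries.coeff_succ_X_mul]
    simp [circuitSeries, circuits_zero]
  rw [zero_add] at h
  rw [h]
  exact isUnit_one

/-- The compositional inverse `(tG)⁻¹` of the power series `t G(t)`, where `G` is the circuit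
series of `Γ` at `x`. -/
noncomputable def compInvCircuitSeries (Γ : InvGraph V A) (x : V) : ℚ⟦X⟧ :=
  (X * Γ.circuitSeries x).substInvOfIsUnit (Γ.isUnit_coeff_one_X_mul_circuitSeries x)

theorem X_mul_circuitSeries_subst_compInv (Γ : InvGraph V A) (x : V) :
    (X * Γ.circuitSeries x).subst (Γ.compInvCircuitSeries x) = (X : ℚ⟦X⟧) :=
  subst_substInvOfIsUnit_right _ (Γ.constantCoeff_X_mul_circuitSeries x) _

theorem compInv_subst_X_mul_circuitSeries (Γ : InvGraph V A) (x : V) :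
    (Γ.compInvCircuitSeries x).subst (X * Γ.circuitSeries x) = (X : ℚ⟦X⟧) :=
  subst_substInvOfIsUnit_left _ (Γ.constantCoeff_X_mul_circuitSeries x) _

/-! ### Free products

Starting from the root, a vertex of the free product of `(Γ, o)` and `(Δ, o')` is reached by going
to a vertex `≠ o` of a copy of `Γ`, then to a vertex `≠ o'` of the copy of `Δ` glued there, and so
on (or the same with the roles of `Γ` and `Δ` exchanged). So the vertices are the alternating words
in the vertices `≠ o` of `Γ` and the vertices `≠ o'` of `Δ`. In the lists below the most recent
letter comes first, and the root is the empty word. -/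

/-- Alternating words in the non-base vertices of the two factors. -/
def FreeVertex (o : V) (o' : W) : Type _ :=
  {w : List ({v : V // v ≠ o} ⊕ {v : W // v ≠ o'}) //
    w.IsChain fun a b => a.isLeft ≠ b.isLeft}

/-- The root of the free product, where the initial copies of the two factors are identified. -/
def FreeVertex.root (o : V) (o' : W) : FreeVertex o o' := ⟨[], .nil⟩

/-- The vertices at which a copy of the first factor is glued by its base point: the root, and the
new vertices of the copies of the second factor. -/
def LeftSite (o : V) (o' : W) : Type _ :=
  {w : FreeVertex o o' // ∀ a ∈ w.1.head?, a.isRight = true}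

/-- The vertices at which a copy of the second factor is glued by its base point: the root, and the
new vertices of the copies of the first factor. -/
def RightSite (o : V) (o' : W) : Type _ :=
  {w : FreeVertex o o' // ∀ a ∈ w.1.head?, a.isLeft = true}

open Classical in
/-- The vertex `v` of the copy of the first factor glued at the site `s`. -/
noncomputable def LeftSite.vertex {o : V} {o' : W} (s : LeftSite o o') (v : V) :
    FreeVertex o o' :=
  if h : v = o then s.1
  else ⟨Sum.inl ⟨v, h⟩ :: s.1.1, s.1.2.cons fun a ha => by
    have := s.2 a ha
    cases a <;> simp_all⟩

open Classical in
/-- The vertex `v` of the copy of the second factor glued at the site `s`. -/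
noncomputable def RightSite.vertex {o : V} {o' : W} (s : RightSite o o') (v : W) :
    FreeVertex o o' :=
  if h : v = o' then s.1
  else ⟨Sum.inr ⟨v, h⟩ :: s.1.1, s.1.2.cons fun a ha => by
    have := s.2 a ha
    cases a <;> simp_all⟩

/-- The free product of the pointed graphs `(Γ, o)` and `(Δ, o')`. Its edges are the edges of all
the glued copies of `Γ` and `Δ`. -/
noncomputable def freeProduct (Γ : InvGraph V A) (o : V) (Δ : InvGraph W B) (o' : W) :
    InvGraph (FreeVertex o o') (LeftSite o o' × A ⊕ RightSite o o' × B) where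
  src := Sum.elim (fun e => e.1.vertex (Γ.src e.2)) (fun e => e.1.vertex (Δ.src e.2))
  tgt := Sum.elim (fun e => e.1.vertex (Γ.tgt e.2)) (fun e => e.1.vertex (Δ.tgt e.2))
  inv := Sum.map (Prod.map id Γ.inv) (Prod.map id Δ.inv)
  inv_inv := by
    rintro (⟨s, e⟩ | ⟨s, e⟩) <;> simp [Γ.inv_inv, Δ.inv_inv]
  src_inv := by
    rintro (⟨s, e⟩ | ⟨s, e⟩) <;> simp [Γ.src_inv, Δ.src_inv]

end InvGraph

namespace PowerSeries

/-! Splitting off the first edge gives a linear recurrence for the series of paths from a varying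
vertex to a fixed one, and this recurrence has only one solution. So the series of the free product
may be guessed and checked locally. The guess is multiplicative along the alternating word of a
vertex: `G` times one factor per letter, the factor of a letter `v` being (paths from `v` to
base)/(circuits at base) in its graph, evaluated at a new variable, `s` for `E` and `s'` for `F`.

The check at a vertex involves one copy of each factor. It succeeds when `s * G_E(s) = s' * G_F(s')
= t * G` and `G = G_E(s) + G_F(s') - 1` (`circuitSeries_freeProduct`). The first conditions say that
`s` and `s'` are `(tG_E)⁻¹` and `(tG_F)⁻¹` evaluated at `tG`. Composing the last one with `(tG)⁻¹`
makes `G_Γ((tG_Γ)⁻¹)` additive up to `-1`. Since `f * G(f) = t` for `f = (tG)⁻¹`, dividing by `t`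
gives the formula for reciprocals. -/

theorem constantCoeff_subst_of_constantCoeff_eq_zero {R : Type*} [CommRing R] {s : R⟦X⟧}
    (hs : s.constantCoeff = 0) (f : R⟦X⟧) :
    constantCoeff (R := R) (f.subst s) = f.constantCoeff := by
  have hs' : HasSubst s := .of_constantCoeff_zero' hs
  -- Write `f = f(0) + X * g`; substitution turns the second term into a multiple of `s`.
  obtain ⟨g, hg⟩ : X ∣ f - C f.constantCoeff := by
    rw [X_dvd_iff]; simp
  have hf : f = X * g + C f.constantCoeff := by rw [← hg]; ring
  have h : (f.subst s : R⟦X⟧) = s * g.subst s + C f.constantCoeff := by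
    conv_lhs => rw [hf]
    rw [subst_add hs', subst_mul hs', subst_X hs', subst_C]
    rfl
  rw [h, map_add, map_mul, hs, zero_mul, zero_add, constantCoeff_C]

end PowerSeries

namespace InvGraph

variable {V A W B : Type*}

/-! ### Generating series of paths -/

/-- The paths of length `n` from `x` to `y`. -/
def paths (Γ : InvGraph V A) (x y : V) (n : ℕ) : Set (List A) :=
  {p | Γ.IsPath x p y ∧ p.length = n}

/-- The generating series of the paths from `x` to `y`. -/
noncomputable def pathSeries (Γ : InvGraph V A) (x y : V) : ℚ⟦X⟧ :=
  PowerSeries.mk fun n => ((Γ.paths x y n).ncard : ℚ)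

theorem pathSeries_self (Γ : InvGraph V A) (x : V) : Γ.pathSeries x x = Γ.circuitSeries x := rfl

theorem paths_succ {Γ : InvGraph V A} (h : Γ.LocallyFinite) (x y : V) (n : ℕ) :
    Γ.paths x y (n + 1) =
      ⋃ e ∈ (h x).toFinset, List.cons e '' Γ.paths (Γ.tgt e) y n := by
  ext p
  cases p with
  | nil => simp [paths]
  | cons e p => simp [paths, IsPath, and_assoc, and_comm]

/-- Ensures that `ncard` is a true count, since it is `0` on infinite sets. -/
theorem paths_finite {Γ : InvGraph V A} (h : Γ.LocallyFinite) (x y : V) (n : ℕ) :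
    (Γ.paths x y n).Finite := by
  induction n generalizing x with
  | zero => exact (Set.finite_singleton []).subset fun p hp => List.length_eq_zero_iff.1 hp.2
  | succ n ih =>
    rw [paths_succ h]
    exact Set.Finite.biUnion (Finset.finite_toSet _) fun e _ => (ih _).image _

/-- A path determines its first edge, so the union over first edges is disjoint. -/
theorem ncard_paths_succ {Γ : InvGraph V A} (h : Γ.LocallyFinite) (x y : V) (n : ℕ) :
    (Γ.paths x y (n + 1)).ncard = ∑ e ∈ (h x).toFinset, (Γ.paths (Γ.tgt e) y n).ncard := by
  classical
  have key : Γ.paths x y (n + 1) = ((h x).toFinset.biUnion fun e =>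
      ((paths_finite h (Γ.tgt e) y n).toFinset.image (List.cons e)) : Finset (List A)) := by
    rw [paths_succ h]
    simp
  rw [key, Set.ncard_coe_finset, Finset.card_biUnion]
  · refine Finset.sum_congr rfl fun e _ => ?_
    rw [Finset.card_image_of_injective _ (List.cons_injective),
      Set.ncard_eq_toFinset_card _ (paths_finite h (Γ.tgt e) y n)]
  · intro e _ e' _ hee
    rw [Function.onFun, Finset.disjoint_left]
    intro p hp hp'
    obtain ⟨q, -, rfl⟩ := Finset.mem_image.1 hp
    obtain ⟨q', -, hq⟩ := Finset.mem_image.1 hp'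
    exact hee (List.cons.inj hq).1.symm

open Classical in
theorem ncard_paths_zero (Γ : InvGraph V A) (x y : V) :
    (Γ.paths x y 0).ncard = if x = y then 1 else 0 := by
  split_ifs with h
  · subst h
    exact (congrArg Set.ncard (Γ.circuits_zero x)).trans (Set.ncard_singleton _)
  · rw [show Γ.paths x y 0 = ∅ from ?_, Set.ncard_empty]
    ext p
    cases p <;> simp [paths, IsPath, h]

open Classical in
/-- The path series satisfy the recurrence obtained by splitting off the first edge. -/
theorem pathSeries_eq {Γ : InvGraph V A} (h : Γ.LocallyFinite) (x y : V) :
    Γ.pathSeries x y =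
      (if x = y then 1 else 0) + X * ∑ e ∈ (h x).toFinset, Γ.pathSeries (Γ.tgt e) y := by
  ext n
  cases n with
  | zero =>
    simp only [pathSeries, coeff_mk, ncard_paths_zero]
    split_ifs <;> simp
  | succ n =>
    rw [map_add, coeff_succ_X_mul, map_sum]
    simp only [pathSeries, coeff_mk, ncard_paths_succ h]
    split_ifs <;> simp [coeff_one]

open Classical in
/-- The recurrence for path series has a unique solution. -/
theorem eq_pathSeries_of_recurrence {Γ : InvGraph V A} (h : Γ.LocallyFinite) (y : V)
    (f : V → ℚ⟦X⟧)
    (hf : ∀ x, f x = (if x = y then 1 else 0) + X * ∑ e ∈ (h x).toFinset, f (Γ.tgt e)) (x : V) :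
    f x = Γ.pathSeries x y := by
  ext n
  induction n generalizing x with
  | zero =>
    rw [hf, pathSeries_eq h]
    simp
  | succ n ih =>
    -- The factor `X` makes coefficient `n + 1` depend only on coefficients `n` at the neighbours.
    rw [hf, pathSeries_eq h]
    simp only [map_add, coeff_succ_X_mul, map_sum, ih]

/-! ### Vertices and edges of free products -/

section FreeProduct

variable {o : V} {o' : W}

theorem LeftSite.vertex_base (s : LeftSite o o') : s.vertex o = s.1 := dif_pos rfl

theorem RightSite.vertex_base (s : RightSite o o') : s.vertex o' = s.1 := dif_pos rfl

theorem LeftSite.vertex_of_ne (s : LeftSite o o') {v : V} (h : v ≠ o) :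
    (s.vertex v).1 = Sum.inl ⟨v, h⟩ :: s.1.1 := by
  exact congrArg Subtype.val (dif_neg h)

theorem RightSite.vertex_of_ne (s : RightSite o o') {v : W} (h : v ≠ o') :
    (s.vertex v).1 = Sum.inr ⟨v, h⟩ :: s.1.1 := by
  exact congrArg Subtype.val (dif_neg h)

/-- The site and the vertex can be read off the word: a left site never begins with a left letter,
so such a letter at the head is exactly what `vertex` added. -/
theorem LeftSite.vertex_inj {s s' : LeftSite o o'} {v v' : V} (h : s.vertex v = s'.vertex v') :
    s = s' ∧ v = v' := by
  have h1 := congrArg Subtype.val h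
  by_cases hv : v = o <;> by_cases hv' : v' = o
  · subst hv hv'
    rw [vertex_base, vertex_base] at h
    exact ⟨Subtype.ext h, rfl⟩
  · subst hv
    rw [vertex_base, vertex_of_ne _ hv'] at h1
    have := s.2 (Sum.inl ⟨v', hv'⟩) (by rw [h1]; rfl)
    simp at this
  · subst hv'
    rw [vertex_base, vertex_of_ne _ hv] at h1
    have := s'.2 (Sum.inl ⟨v, hv⟩) (by rw [← h1]; rfl)
    simp at this
  · rw [vertex_of_ne _ hv, vertex_of_ne _ hv'] at h1
    have h2 := List.cons.inj h1
    exact ⟨Subtype.ext (Subtype.ext h2.2), congrArg Subtype.val (Sum.inl.inj h2.1)⟩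

theorem RightSite.vertex_inj {s s' : RightSite o o'} {v v' : W} (h : s.vertex v = s'.vertex v') :
    s = s' ∧ v = v' := by
  have h1 := congrArg Subtype.val h
  by_cases hv : v = o' <;> by_cases hv' : v' = o'
  · subst hv hv'
    rw [vertex_base, vertex_base] at h
    exact ⟨Subtype.ext h, rfl⟩
  · subst hv
    rw [vertex_base, vertex_of_ne _ hv'] at h1
    have := s.2 (Sum.inr ⟨v', hv'⟩) (by rw [h1]; rfl)
    simp at this
  · subst hv'
    rw [vertex_base, vertex_of_ne _ hv] at h1
    have := s'.2 (Sum.inr ⟨v, hv⟩) (by rw [← h1]; rfl)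
    simp at this
  · rw [vertex_of_ne _ hv, vertex_of_ne _ hv'] at h1
    have h2 := List.cons.inj h1
    exact ⟨Subtype.ext (Subtype.ext h2.2), congrArg Subtype.val (Sum.inr.inj h2.1)⟩

/-- Every vertex lies in exactly one copy of each factor. It is the base point of at least one of
these two copies, and of both only if it is the root. -/
theorem FreeVertex.exists_vertex_eq (w : FreeVertex o o') :
    ∃ (s : LeftSite o o') (v : V) (s' : RightSite o o') (v' : W),
      s.vertex v = w ∧ s'.vertex v' = w ∧
      ((w = root o o' ∧ v = o ∧ v' = o') ∨ (w ≠ root o o' ∧ v ≠ o ∧ v' = o') ∨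
        (w ≠ root o o' ∧ v = o ∧ v' ≠ o')) := by
  obtain ⟨l, hl⟩ := w
  match l, hl with
  | [], hl =>
    exact ⟨⟨⟨[], hl⟩, by simp⟩, o, ⟨⟨[], hl⟩, by simp⟩, o', LeftSite.vertex_base _,
      RightSite.vertex_base _, .inl ⟨rfl, rfl, rfl⟩⟩
  | .inl v :: l, hl =>
    refine ⟨⟨⟨l, hl.tail⟩, fun a ha => ?_⟩, v.1, ⟨⟨.inl v :: l, hl⟩, by simp⟩, o', ?_,
      RightSite.vertex_base _, .inr (.inl ⟨?_, v.2, rfl⟩)⟩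
    · have := (List.isChain_cons.1 hl).1 a ha
      cases a <;> simp_all
    · exact Subtype.ext (LeftSite.vertex_of_ne _ v.2)
    · exact fun h => List.cons_ne_nil _ _ (congrArg Subtype.val h)
  | .inr v :: l, hl =>
    refine ⟨⟨⟨.inr v :: l, hl⟩, by simp⟩, o, ⟨⟨l, hl.tail⟩, fun a ha => ?_⟩, v.1,
      LeftSite.vertex_base _, ?_, .inr (.inr ⟨?_, rfl, v.2⟩)⟩
    · have := (List.isChain_cons.1 hl).1 a ha
      cases a <;> simp_all
    · exact Subtype.ext (RightSite.vertex_of_ne _ v.2)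
    · exact fun h => List.cons_ne_nil _ _ (congrArg Subtype.val h)

/-- The edges at a vertex of the free product are the edges at that vertex in the two copies of
the factors which contain it. -/
theorem freeProduct_src_eq_iff (E : InvGraph V A) (F : InvGraph W B) {s : LeftSite o o'} {v : V}
    {s' : RightSite o o'} {v' : W} (h : s.vertex v = s'.vertex v')
    (e : LeftSite o o' × A ⊕ RightSite o o' × B) :
    (E.freeProduct o F o').src e = s.vertex v ↔
      (∃ a, E.src a = v ∧ e = .inl (s, a)) ∨ ∃ b, F.src b = v' ∧ e = .inr (s', b) := by
  constructor
  · intro he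
    rcases e with ⟨r, a⟩ | ⟨r, b⟩
    · obtain ⟨rfl, rfl⟩ := LeftSite.vertex_inj he
      exact .inl ⟨a, rfl, rfl⟩
    · obtain ⟨rfl, rfl⟩ := RightSite.vertex_inj (he.trans h)
      exact .inr ⟨b, rfl, rfl⟩
  · rintro (⟨a, rfl, rfl⟩ | ⟨b, rfl, rfl⟩)
    · rfl
    · exact h.symm

theorem LocallyFinite.freeProduct {E : InvGraph V A} {F : InvGraph W B}
    (hE : E.LocallyFinite) (hF : F.LocallyFinite) (o : V) (o' : W) :
    (E.freeProduct o F o').LocallyFinite := by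
  intro w
  obtain ⟨s, v, s', v', h, h', -⟩ := w.exists_vertex_eq
  refine (((hE v).image fun a => Sum.inl (s, a)).union
    ((hF v').image fun b => Sum.inr (s', b))).subset fun e he => ?_
  subst h
  rcases (freeProduct_src_eq_iff E F h'.symm e).1 he with ⟨a, ha, rfl⟩ | ⟨b, hb, rfl⟩
  · exact .inl ⟨a, ha, rfl⟩
  · exact .inr ⟨b, hb, rfl⟩

/-- Turns the recurrence at a vertex of the free product into one local sum in each factor. -/
theorem sum_freeProduct_edges {M : Type*} [AddCommMonoid M] {E : InvGraph V A} {F : InvGraph W B}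
    (hE : E.LocallyFinite) (hF : F.LocallyFinite) {s : LeftSite o o'} {v : V}
    {s' : RightSite o o'} {v' : W} (h : s.vertex v = s'.vertex v') (f : FreeVertex o o' → M) :
    ∑ e ∈ (hE.freeProduct hF o o' (s.vertex v)).toFinset, f ((E.freeProduct o F o').tgt e) =
      ∑ a ∈ (hE v).toFinset, f (s.vertex (E.tgt a)) +
        ∑ b ∈ (hF v').toFinset, f (s'.vertex (F.tgt b)) := by
  have key : (hE.freeProduct hF o o' (s.vertex v)).toFinset =
      ((hE v).toFinset.map ⟨Prod.mk s, Prod.mk_right_injective s⟩).disjSum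
        ((hF v').toFinset.map ⟨Prod.mk s', Prod.mk_right_injective s'⟩) := by
    ext e
    rw [Set.Finite.mem_toFinset, Set.mem_ofPred_eq, freeProduct_src_eq_iff E F h]
    simp [Finset.mem_disjSum, and_assoc, eq_comm]
  rw [key, Finset.sum_disjSum, Finset.sum_map, Finset.sum_map]
  rfl

/-! ### The path series of a free product -/

/-- The product of the values of `P` and `Q` on the letters of the word `w`. -/
def FreeVertex.weight {R : Type*} [CommRing R] (P : V → R) (Q : W → R) (w : FreeVertex o o') : R :=
  (w.1.map (Sum.elim (fun v => P v.1) (fun v => Q v.1))).prod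

variable {R : Type*} [CommRing R] {P : V → R} {Q : W → R}

theorem FreeVertex.weight_root : (root o o').weight P Q = 1 := rfl

/-- The base vertex adds no letter; the normalization `P o = 1` lets one formula cover this case
too. -/
theorem LeftSite.weight_vertex (hP : P o = 1) (s : LeftSite o o') (v : V) :
    (s.vertex v).weight P Q = s.1.weight P Q * P v := by
  by_cases hv : v = o
  · subst hv
    rw [vertex_base, hP, mul_one]
  · simp [FreeVertex.weight, vertex_of_ne s hv, mul_comm]

theorem RightSite.weight_vertex (hQ : Q o' = 1) (s : RightSite o o') (v : W) :
    (s.vertex v).weight P Q = s.1.weight P Q * Q v := by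
  by_cases hv : v = o'
  · subst hv
    rw [vertex_base, hQ, mul_one]
  · simp [FreeVertex.weight, vertex_of_ne s hv, mul_comm]

end FreeProduct

/-! ### Change of variable in the factors and verification of the recurrence -/

theorem constantCoeff_circuitSeries (Γ : InvGraph V A) (x : V) :
    (Γ.circuitSeries x).constantCoeff = 1 := by
  rw [← coeff_zero_eq_constantCoeff_apply]
  simp [circuitSeries, circuits_zero]

theorem constantCoeff_circuitSeries_subst (Γ : InvGraph V A) (x : V) {s : ℚ⟦X⟧}
    (hs : s.constantCoeff = 0) :
    constantCoeff (R := ℚ) ((Γ.circuitSeries x).subst s) = 1 := by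
  rw [constantCoeff_subst_of_constantCoeff_eq_zero hs, constantCoeff_circuitSeries]

open Classical in
/-- After a change of the variable, the ratios of the path series to the circuit series satisfy a
recurrence of the form needed in a free product. -/
theorem exists_normalized_pathSeries {Γ : InvGraph V A} (h : Γ.LocallyFinite) (o : V)
    {s G : ℚ⟦X⟧} (hs : s.constantCoeff = 0) (hG : s * (Γ.circuitSeries o).subst s = X * G) :
    ∃ P : V → ℚ⟦X⟧, P o = 1 ∧ ∀ v, G * (X * ∑ a ∈ (h v).toFinset, P (Γ.tgt a)) =
      (Γ.circuitSeries o).subst s * P v - if v = o then 1 else 0 := by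
  have hs' : HasSubst s := .of_constantCoeff_zero' hs
  set c : ℚ⟦X⟧ := (Γ.circuitSeries o).subst s with hc
  have hc1 : c.constantCoeff ≠ 0 := by
    rw [hc, constantCoeff_circuitSeries_subst _ _ hs]
    exact one_ne_zero
  have hcc : c * c⁻¹ = 1 := PowerSeries.mul_inv_cancel c hc1
  have hrec (v : V) : ((Γ.pathSeries v o).subst s : ℚ⟦X⟧) = (if v = o then 1 else 0) +
      s * ∑ a ∈ (h v).toFinset, (Γ.pathSeries (Γ.tgt a) o).subst s := by
    conv_lhs => rw [pathSeries_eq h v o]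
    simp only [← coe_substAlgHom (R := ℚ) hs', map_add, map_mul, map_sum, substAlgHom_X]
    split_ifs <;> simp
  -- Dividing by `c` gives value `1` at the base; `s * c = X * G` then trades the step variable `s`
  -- for `X`, at the cost of the factors `c` and `G`.
  refine ⟨fun v => (Γ.pathSeries v o).subst s * c⁻¹, hcc, fun v => ?_⟩
  rw [← Finset.sum_mul]
  linear_combination (-c⁻¹ * ∑ a ∈ (h v).toFinset, (Γ.pathSeries (Γ.tgt a) o).subst s) * hG
    - hrec v + (s * ∑ a ∈ (h v).toFinset, (Γ.pathSeries (Γ.tgt a) o).subst s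
      - (Γ.pathSeries v o).subst s) * hcc

/-- The circuit series of a free product in terms of the solutions of a system of functional
equations. -/
theorem circuitSeries_freeProduct {E : InvGraph V A} {F : InvGraph W B}
    (hE : E.LocallyFinite) (hF : F.LocallyFinite) (o : V) (o' : W) {s s' G : ℚ⟦X⟧}
    (hs : s.constantCoeff = 0) (hs' : s'.constantCoeff = 0)
    (h : s * (E.circuitSeries o).subst s = X * G)
    (h' : s' * (F.circuitSeries o').subst s' = X * G)
    (hG : G = (E.circuitSeries o).subst s + (F.circuitSeries o').subst s' - 1) :
    (E.freeProduct o F o').circuitSeries (FreeVertex.root o o') = G := by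
  classical
  obtain ⟨P, hP, hPr⟩ := exists_normalized_pathSeries hE o hs h
  obtain ⟨Q, hQ, hQr⟩ := exists_normalized_pathSeries hF o' hs' h'
  rw [← pathSeries_self, ← eq_pathSeries_of_recurrence (hE.freeProduct hF o o') _
    (fun w => G * w.weight P Q) ?_, FreeVertex.weight_root, mul_one]
  intro w
  obtain ⟨r, v, r', v', hv, hv', hw⟩ := w.exists_vertex_eq
  have hwP := LeftSite.weight_vertex (Q := Q) hP r v
  have hwQ := RightSite.weight_vertex (P := P) hQ r' v'
  rw [hv] at hwP
  rw [hv'] at hwQ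
  have hsum : ∑ e ∈ (hE.freeProduct hF o o' w).toFinset,
      G * ((E.freeProduct o F o').tgt e).weight P Q =
        r.1.weight P Q * (G * ∑ a ∈ (hE v).toFinset, P (E.tgt a)) +
          r'.1.weight P Q * (G * ∑ b ∈ (hF v').toFinset, Q (F.tgt b)) := by
    subst hv
    rw [sum_freeProduct_edges hE hF hv'.symm fun w => G * w.weight P Q]
    simp only [LeftSite.weight_vertex hP, RightSite.weight_vertex hQ, Finset.mul_sum]
    congr 1 <;> exact Finset.sum_congr rfl fun _ _ => by ring
  refine Eq.trans ?_ (congrArg (fun z => (if w = FreeVertex.root o o' then 1 else 0) + X * z)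
    hsum.symm)
  -- At the root both local Kronecker terms are `1`, against `1 + 1`. Elsewhere `w` is the base of
  -- exactly one of its two copies, whose site is `w` itself, so one term survives and equals the
  -- weight of `w`.
  have hδ : (if w = FreeVertex.root o o' then 1 else 0 : ℚ⟦X⟧) + w.weight P Q =
      r.1.weight P Q * (if v = o then 1 else 0) + r'.1.weight P Q * if v' = o' then 1 else 0 := by
    rcases hw with ⟨rfl, rfl, rfl⟩ | ⟨hw, hvo, rfl⟩ | ⟨hw, rfl, hvo⟩
    · rw [hP, mul_one] at hwP
      rw [hQ, mul_one] at hwQ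
      simp [← hwP, ← hwQ, FreeVertex.weight_root]
    · rw [hQ, mul_one] at hwQ
      simp [hw, hvo, hwQ]
    · rw [hP, mul_one] at hwP
      simp [hw, hvo, hwP]
  -- The two local recurrences add up to `weight * (G_E(s) + G_F(s') - 1)` minus the Kronecker term
  -- of the root; the `-1` comes from `hδ`.
  linear_combination w.weight P Q * hG - hδ + (E.circuitSeries o).subst s * hwP
    + (F.circuitSeries o').subst s' * hwQ - r.1.weight P Q * hPr v - r'.1.weight P Q * hQr v'

/-! ### Compositional inverses and reciprocals -/

theorem constantCoeff_compInvCircuitSeries (Γ : InvGraph V A) (x : V) :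
    (Γ.compInvCircuitSeries x).constantCoeff = 0 :=
  constantCoeff_substInvOfIsUnit _ _

theorem hasSubst_compInvCircuitSeries (Γ : InvGraph V A) (x : V) :
    HasSubst (Γ.compInvCircuitSeries x) :=
  .of_constantCoeff_zero' (Γ.constantCoeff_compInvCircuitSeries x)

theorem compInv_mul_circuitSeries_subst (Γ : InvGraph V A) (x : V) :
    Γ.compInvCircuitSeries x * (Γ.circuitSeries x).subst (Γ.compInvCircuitSeries x) = X := by
  have h := Γ.X_mul_circuitSeries_subst_compInv x
  rwa [subst_mul (Γ.hasSubst_compInvCircuitSeries x),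
    subst_X (Γ.hasSubst_compInvCircuitSeries x)] at h

/-- Solves `s * G(s) = u` by `s = (tG)⁻¹(u)`, which supplies the changes of variable. -/
theorem compInv_subst_mul_circuitSeries_subst (Γ : InvGraph V A) (x : V) {u : ℚ⟦X⟧}
    (hu : HasSubst u) : (Γ.compInvCircuitSeries x).subst u *
      (Γ.circuitSeries x).subst ((Γ.compInvCircuitSeries x).subst u : ℚ⟦X⟧) = u := by
  rw [← subst_comp_subst_apply (Γ.hasSubst_compInvCircuitSeries x) hu, ← subst_mul hu,
    compInv_mul_circuitSeries_subst, subst_X hu]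

/-- A left compositional inverse of `t G(t)` is equal to `(tG)⁻¹`. -/
theorem eq_compInvCircuitSeries (Γ : InvGraph V A) (x : V) {f : ℚ⟦X⟧}
    (hf : f.subst (X * Γ.circuitSeries x) = (X : ℚ⟦X⟧)) : f = Γ.compInvCircuitSeries x := by
  have hu : HasSubst (X * Γ.circuitSeries x) :=
    .of_constantCoeff_zero' (Γ.constantCoeff_X_mul_circuitSeries x)
  have h := subst_comp_subst_apply hu (Γ.hasSubst_compInvCircuitSeries x) f
  rwa [hf, subst_X (Γ.hasSubst_compInvCircuitSeries x), X_mul_circuitSeries_subst_compInv,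
    X_subst, eq_comm] at h

/-- From `f * G(f) = X` with `f = (tG)⁻¹`; it reduces the Laurent series identity to one of power
series. -/
theorem coe_compInvCircuitSeries_inv (Γ : InvGraph V A) (x : V) :
    ((Γ.compInvCircuitSeries x : ℚ⟦X⟧) : LaurentSeries ℚ)⁻¹ =
      (((Γ.circuitSeries x).subst (Γ.compInvCircuitSeries x) : ℚ⟦X⟧) : LaurentSeries ℚ) *
        ((X : ℚ⟦X⟧) : LaurentSeries ℚ)⁻¹ := by
  have h := congrArg (HahnSeries.ofPowerSeries ℤ ℚ) (Γ.compInv_mul_circuitSeries_subst x)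
  rw [map_mul] at h
  have hX : HahnSeries.ofPowerSeries ℤ ℚ X ≠ 0 := by
    simp
  rw [← h] at hX ⊢
  have h1 := left_ne_zero_of_mul hX
  have h2 := right_ne_zero_of_mul hX
  field_simp

/-- The reciprocal of `(tG)⁻¹ / t` is additive up to a constant under free products. -/
theorem circuitSeries_freeProduct_subst_compInv {E : InvGraph V A} {F : InvGraph W B}
    (hE : E.LocallyFinite) (hF : F.LocallyFinite) (o : V) (o' : W) :
    ((E.freeProduct o F o').circuitSeries (FreeVertex.root o o')).subst
        ((E.freeProduct o F o').compInvCircuitSeries (FreeVertex.root o o')) =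
      ((E.circuitSeries o).subst (E.compInvCircuitSeries o) +
        (F.circuitSeries o').subst (F.compInvCircuitSeries o') - 1 : ℚ⟦X⟧) := by
  set b : ℚ⟦X⟧ := (E.circuitSeries o).subst (E.compInvCircuitSeries o) +
    (F.circuitSeries o').subst (F.compInvCircuitSeries o') - 1 with hb
  have hb1 : b.constantCoeff = 1 := by
    rw [hb, map_sub, map_add,
      constantCoeff_circuitSeries_subst _ _ (constantCoeff_compInvCircuitSeries _ _),
      constantCoeff_circuitSeries_subst _ _ (constantCoeff_compInvCircuitSeries _ _), map_one]
    norm_num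
  have hbb : b * b⁻¹ = 1 := PowerSeries.mul_inv_cancel b (by rw [hb1]; exact one_ne_zero)
  have hφ0 : (X * b⁻¹).constantCoeff = 0 := by simp
  have hφ1 : IsUnit ((X * b⁻¹).coeff 1) := by
    have : (X * b⁻¹).coeff (0 + 1) = 1 := by
      rw [coeff_succ_X_mul]
      simp [hb1]
    rw [zero_add] at this
    rw [this]
    exact isUnit_one
  -- The expected value of `(tG_Γ)⁻¹` is `X / b`, so its compositional inverse, written `X * G`, is
  -- the candidate for `t * G_Γ`.
  obtain ⟨G, hG⟩ : X ∣ (X * b⁻¹).substInvOfIsUnit hφ1 :=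
    X_dvd_iff.2 (constantCoeff_substInvOfIsUnit _ _)
  have hφu := subst_substInvOfIsUnit_right (X * b⁻¹) hφ0 hφ1
  rw [hG] at hφu
  have hu0 : (X * G).constantCoeff = 0 := by simp
  have hu : HasSubst (X * G) := .of_constantCoeff_zero' hu0
  have hub : X * G = X * b.subst (X * G) := by
    have h : X * b⁻¹ * b = X := by rw [mul_assoc, mul_comm b⁻¹, hbb, mul_one]
    have h2 := congrArg (subst (X * G)) h
    rwa [subst_mul hu, subst_X hu, hφu, eq_comm] at h2
  have hGb : G = b.subst (X * G) := mul_left_cancel₀ X_ne_zero hub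
  have key : (E.freeProduct o F o').circuitSeries (FreeVertex.root o o') = G := by
    refine circuitSeries_freeProduct hE hF o o'
      (s := (E.compInvCircuitSeries o).subst (X * G))
      (s' := (F.compInvCircuitSeries o').subst (X * G)) ?_ ?_ ?_ ?_ ?_
    · rw [constantCoeff_subst_of_constantCoeff_eq_zero hu0, constantCoeff_compInvCircuitSeries]
    · rw [constantCoeff_subst_of_constantCoeff_eq_zero hu0, constantCoeff_compInvCircuitSeries]
    · exact compInv_subst_mul_circuitSeries_subst E o hu
    · exact compInv_subst_mul_circuitSeries_subst F o' hu
    · conv_lhs => rw [hGb, hb]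
      rw [subst_sub hu, subst_add hu, subst_comp_subst_apply (hasSubst_compInvCircuitSeries _ _) hu,
        subst_comp_subst_apply (hasSubst_compInvCircuitSeries _ _) hu, ← coe_substAlgHom (R := ℚ) hu,
        map_one]
  -- With `G` identified as the circuit series, `X / b` is the compositional inverse; then `(X / b)
  -- * G_Γ(X / b) = X` forces `G_Γ(X / b) = b`.
  have hcomp := eq_compInvCircuitSeries (E.freeProduct o F o') (FreeVertex.root o o')
    (f := X * b⁻¹) (by rw [key]; exact hφu)
  have h := compInv_mul_circuitSeries_subst (E.freeProduct o F o') (FreeVertex.root o o')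
  rw [← hcomp] at h ⊢
  rw [mul_assoc] at h
  have h1 := mul_left_cancel₀ X_ne_zero (h.trans (mul_one X).symm)
  linear_combination b * h1 - (subst (X * b⁻¹) ((E.freeProduct o F o').circuitSeries
    (FreeVertex.root o o'))) * hbb

end InvGraph

theorem mainTheorem5 {V A W B : Type*} (E : InvGraph V A) (o : V) (F : InvGraph W B) (o' : W)
    (hE : E.Connected) (hF : F.Connected) (hE' : E.LocallyFinite) (hF' : F.LocallyFinite) :
    (E.freeProduct o F o').LocallyFinite ∧
    (((E.freeProduct o F o').compInvCircuitSeries (InvGraph.FreeVertex.root o o') :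
        ℚ⟦X⟧) : LaurentSeries ℚ)⁻¹ =
      ((E.compInvCircuitSeries o : ℚ⟦X⟧) : LaurentSeries ℚ)⁻¹ +
        ((F.compInvCircuitSeries o' : ℚ⟦X⟧) : LaurentSeries ℚ)⁻¹ -
        ((X : ℚ⟦X⟧) : LaurentSeries ℚ)⁻¹ := by
  refine ⟨hE'.freeProduct hF' o o', ?_⟩
  rw [InvGraph.coe_compInvCircuitSeries_inv, InvGraph.coe_compInvCircuitSeries_inv,
    InvGraph.coe_compInvCircuitSeries_inv,
    InvGraph.circuitSeries_freeProduct_subst_compInv hE' hF', map_sub, map_add, map_one]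
  ring
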